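/- A computable copy of $(\omega,<)$ is a structure $\mathcal A=(\omega,\prec)$ in which $\prec$ is a computable linear ordering of $\omega$ and which is isomorphic to $(\omega,<)$. For $R\subseteq\omega^k$ and a computable copy $\mathcal A$, let $R_{\mathcal A}$ be the image of $R$ under the isomorphism from $(\omega,<)$ to $\mathcal A$. The degree spectrum of $R$ on $(\omega,<)$ is the set of Turing degrees of the relations $R_{\mathcal A}$, over all computable copies $\mathcal A$ of $(\omega,<)$; $R$ is intrinsically computable if its degree spectrum contains only the computable degree. A function $f:\omega\to\omega$ is called intrinsically computable if its graph $\{(x,y): f(x)=y\}$ is. Proposition. Let $f:\omega\to\omega$ be a total computable function. Then $f$ is intrinsically computable if and only if either $f$ is almost constant (there is $c$ such that $f(x)=c$ for all but finitely many $x$) or $f$ is almost identity ($f(x)=x$ for all but finitely many $x$). -/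

import Mathlib

noncomputable section

/-- The Turing degree of a set of natural numbers: the degree of its characteristic function. -/
def degSet (X : Set ℕ) : TuringDegree :=
  toAntisymmetrization TuringReducible
    (open Classical in fun n => Part.some (if n ∈ X then 1 else 0))

/-- The degree of the computable sets. -/
def computableDegree : TuringDegree := degSet ∅

/-- The Turing degree of a subset of a type with a standard coding by natural numbers: the degree
of the set of codes of its elements. -/
def degCoded {α : Type} [Primcodable α] (X : Set α) : TuringDegree :=
  degSet (Encodable.encode '' X)

/-- The Turing degree of a `k`-ary relation on `ℕ` (under the standard primitive recursive coding
of `k`-tuples). -/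
def degRel {k : ℕ} (R : Set (Fin k → ℕ)) : TuringDegree :=
  degCoded R

/-- `(ℕ, lt)` is a computable copy of `(ℕ, <)`: `lt` is a computable (strict linear) ordering of
`ℕ`, and `(ℕ, <)` and `(ℕ, lt)` are isomorphic. -/
structure IsComputableCopy (lt : ℕ → ℕ → Prop) : Prop where
  isOrder : IsStrictTotalOrder ℕ lt
  computable : ComputablePred fun p : ℕ × ℕ => lt p.1 p.2
  isomorphic : Nonempty (((· < ·) : ℕ → ℕ → Prop) ≃r lt)

/-- The image of a `k`-ary relation on `(ℕ, <)` under an isomorphism onto `(ℕ, lt)`. -/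
def imageRel {k : ℕ} {lt : ℕ → ℕ → Prop} (φ : ((· < ·) : ℕ → ℕ → Prop) ≃r lt)
    (R : Set (Fin k → ℕ)) : Set (Fin k → ℕ) :=
  (fun v i => φ (v i)) '' R

/-- The degree spectrum of `R` on `(ℕ, <)`: the Turing degrees of the images of `R` in all
computable copies of `(ℕ, <)`. -/
def degSpectrum {k : ℕ} (R : Set (Fin k → ℕ)) : Set TuringDegree :=
  {d | ∃ lt : ℕ → ℕ → Prop, IsComputableCopy lt ∧
    ∃ φ : ((· < ·) : ℕ → ℕ → Prop) ≃r lt, d = degRel (imageRel φ R)}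

/-- `R` is intrinsically computable: its spectrum contains only the computable degree. -/
def IntrinsicallyComputable {k : ℕ} (R : Set (Fin k → ℕ)) : Prop :=
  degSpectrum R = {computableDegree}

/-- The graph of a unary function, as a binary relation. -/
def graphRel (f : ℕ → ℕ) : Set (Fin 2 → ℕ) :=
  {v | f (v 0) = v 1}

/-- `f` is almost constant: constant with finitely many exceptions. -/
def AlmostConstant (f : ℕ → ℕ) : Prop :=
  ∃ c, {x | f x ≠ c}.Finite

/-- `f` is almost identity: the identity with finitely many exceptions. -/
def AlmostIdentity (f : ℕ → ℕ) : Prop :=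
  {x | f x ≠ x}.Finite

end

/-! If `f` is almost constant or almost the identity, its image in any copy differs finitely from a
constant or the identity, hence is computable.

Conversely, it suffices to find a computable relation `Q`, decidable from the image of the graph in
every copy, whose image is noncomputable in some copy (`exists_computableCopy_not_computablePred`).
That copy codes the halting problem: the `e`-th pair of markers sits at a pair satisfying `Q` and,
once program `e` halts, moves to a pair failing `Q`. A copy under construction only gains elements,
so a move is legal when no gap between consecutive markers shrinks. Hence `Q` must hold at pairs
arbitrarily far out and fail at far pairs with arbitrarily large gaps.

For `f` of neither kind, `Q u v` is `f v = c` if the fibre over `c` is infinite. If all fibres are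
finite, it is `f v = u` or `f u = v`, as `f x < x` or `x < f x` infinitely often. -/

namespace ComputablePred

/-! ### Closure properties of computable predicates -/

variable {α β : Type*} [Primcodable α] [Primcodable β] {p q : α → Prop}

theorem comp_computable {p : β → Prop} {f : α → β} (hp : ComputablePred p) (hf : Computable f) :
    ComputablePred fun a => p (f a) := by
  classical
  exact (hp.decide.comp hf).computablePred

theorem and_pred (hp : ComputablePred p) (hq : ComputablePred q) :
    ComputablePred fun a => p a ∧ q a := by
  classical
  exact Computable.computablePred
    ((Primrec.and.to_comp.comp hp.decide hq.decide).of_eq fun a => by simp)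

theorem or_pred (hp : ComputablePred p) (hq : ComputablePred q) :
    ComputablePred fun a => p a ∨ q a := by
  classical
  exact Computable.computablePred
    ((Primrec.or.to_comp.comp hp.decide hq.decide).of_eq fun a => by simp)

theorem imp_pred (hp : ComputablePred p) (hq : ComputablePred q) :
    ComputablePred fun a => p a → q a :=
  (hp.not.or_pred hq).of_eq fun _ => imp_iff_not_or.symm

theorem le_pred {f g : α → ℕ} (hf : Computable f) (hg : Computable g) :
    ComputablePred fun a => f a ≤ g a :=
  comp_computable (Primrec.nat_le.computablePred) (hf.pair hg)

theorem lt_pred {f g : α → ℕ} (hf : Computable f) (hg : Computable g) :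
    ComputablePred fun a => f a < g a :=
  comp_computable (Primrec.nat_lt.computablePred) (hf.pair hg)

theorem eq_pred {f g : α → β} (hf : Computable f) (hg : Computable g) :
    ComputablePred fun a => f a = g a :=
  comp_computable ((Primrec.eq (α := β)).computablePred) (hf.pair hg)

end ComputablePred

/-! ### From degree spectra to computable predicates -/

theorem degSet_eq_computableDegree {X : Set ℕ} :
    degSet X = computableDegree ↔ ComputablePred (· ∈ X) := by
  classical
  have h0 : Partrec (fun _ : ℕ => Part.some 0) := (Computable.const 0).partrec
  have key : ∀ Y : Set ℕ, Partrec (fun n => Part.some (if n ∈ Y then 1 else 0) : ℕ →. ℕ) ↔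
      ComputablePred (· ∈ Y) := by
    intro Y
    constructor
    · intro h
      have h1 : Computable (fun n => if n ∈ Y then 1 else 0 : ℕ → ℕ) := h
      exact (ComputablePred.eq_pred h1 (Computable.const 1)).of_eq fun n => by simp
    · intro h
      exact (ComputablePred.ite (Computable.const 1) (Computable.const 0) h : Computable _)
  rw [← key X]
  have e0 : (fun n => Part.some (@ite _ (n ∈ (∅ : Set ℕ)) (Classical.propDecidable _) 1 0) :
      ℕ →. ℕ) = fun _ => Part.some 0 := by simp
  constructor
  · intro h
    have h' := (Quotient.exact h).1
    rw [e0] at h'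
    convert! TuringReducible.partrec_of_const h'
  · intro h
    refine Quotient.sound ⟨Partrec.turingReducible ?_, Partrec.turingReducible ?_⟩
    · convert! h
    · rwa [e0]

theorem degCoded_eq_computableDegree {α : Type} [Primcodable α] {X : Set α} :
    degCoded X = computableDegree ↔ ComputablePred (· ∈ X) := by
  classical
  rw [degCoded, degSet_eq_computableDegree]
  constructor
  · intro h
    exact (h.comp_computable Computable.encode).of_eq fun a => by
      simp [Encodable.encode_injective.mem_set_image]
  · intro h
    -- Decoding may succeed on a number that is not a code, so the result is encoded again and
    -- compared.
    have h1 : Computable fun n : ℕ => @Option.casesOn α (fun _ => Bool)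
        (Encodable.decode (α := α) n) false
        (fun a => decide (a ∈ X ∧ Encodable.encode a = n)) := by
      refine Computable.option_casesOn Computable.decode (Computable.const false) ?_
      exact ((h.comp_computable Computable.snd).and_pred
        (ComputablePred.eq_pred (Computable.encode.comp Computable.snd) Computable.fst)).decide
    refine (ComputablePred.eq_pred h1 (Computable.const true)).of_eq fun n => ?_
    constructor
    · rcases hd : Encodable.decode (α := α) n with _ | a
      · simp
      · simp only [decide_eq_true_eq]
        exact fun h => ⟨a, h⟩
    · rintro ⟨a, ha, rfl⟩
      simp [ha]

theorem computablePred_pair_iff {p : ℕ → ℕ → Prop} :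
    ComputablePred (fun v : Fin 2 → ℕ => p (v 0) (v 1)) ↔
      ComputablePred fun x : ℕ × ℕ => p x.1 x.2 := by
  constructor
  · intro h
    have h1 : Computable fun x : ℕ × ℕ => (fun i : Fin 2 => if i = 0 then x.1 else x.2) := by
      refine Primrec.to_comp (Primrec.fin_curry.2 ?_)
      exact Primrec.ite (Primrec.eq.comp Primrec.snd (Primrec.const 0))
        (Primrec.fst.comp Primrec.fst) (Primrec.snd.comp Primrec.fst)
    exact (h.comp_computable h1).of_eq fun x => by simp
  · intro h
    have happ (i : Fin 2) : Computable fun v : Fin 2 → ℕ => v i :=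
      (Computable.fin_app (σ := ℕ) (n := 2)).comp Computable.id (Computable.const i)
    exact h.comp_computable ((happ 0).pair (happ 1))

theorem imageRel_graphRel {lt : ℕ → ℕ → Prop} (φ : ((· < ·) : ℕ → ℕ → Prop) ≃r lt)
    (f : ℕ → ℕ) : imageRel φ (graphRel f) = graphRel fun x => φ (f (φ.symm x)) := by
  ext w
  simp only [imageRel, graphRel, Set.mem_image, Set.mem_ofPred_eq]
  constructor
  · rintro ⟨v, hv, rfl⟩
    simp [hv]
  · intro h
    refine ⟨fun i => φ.symm (w i), ?_, by simp⟩
    simp [← h]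

theorem degRel_imageRel_graphRel {lt : ℕ → ℕ → Prop} (φ : ((· < ·) : ℕ → ℕ → Prop) ≃r lt)
    (f : ℕ → ℕ) : degRel (imageRel φ (graphRel f)) = computableDegree ↔
      ComputablePred fun x : ℕ × ℕ => φ (f (φ.symm x.1)) = x.2 := by
  rw [imageRel_graphRel, degRel, degCoded_eq_computableDegree]
  exact computablePred_pair_iff (p := fun a b => φ (f (φ.symm a)) = b)

theorem Computable.of_finite_ne {f g : ℕ → ℕ} (hg : Computable g) (h : {x | f x ≠ g x}.Finite) :
    Computable f := by
  classical
  generalize hs : {x | f x ≠ g x} = s at h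
  induction s, h using Set.Finite.induction_on generalizing g with
  | empty =>
    refine hg.of_eq fun x => ?_
    by_contra hx
    have : x ∈ {x | f x ≠ g x} := fun h => hx h.symm
    simp [hs] at this
  | @insert a s ha _ ih =>
    refine ih (g := fun x => if x = a then f a else g x)
      (ComputablePred.ite (Computable.const _) hg
        (ComputablePred.eq_pred Computable.id (Computable.const a))) ?_
    ext x
    have hx : x ∈ {x | f x ≠ g x} ↔ x ∈ insert a s := by rw [hs]
    by_cases h : x = a
    · subst h; simp [ha]
    · simpa [h] using hx

theorem intrinsicallyComputable_graphRel_iff {f : ℕ → ℕ} :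
    IntrinsicallyComputable (graphRel f) ↔ ∀ lt : ℕ → ℕ → Prop, IsComputableCopy lt →
      ∀ φ : ((· < ·) : ℕ → ℕ → Prop) ≃r lt,
        ComputablePred fun x : ℕ × ℕ => φ (f (φ.symm x.1)) = x.2 := by
  have hid : IsComputableCopy (· < ·) :=
    ⟨inferInstance, Primrec.nat_lt.computablePred, ⟨RelIso.refl _⟩⟩
  constructor
  · intro h lt hlt φ
    rw [← degRel_imageRel_graphRel]
    have : degRel (imageRel φ (graphRel f)) ∈ degSpectrum (graphRel f) := ⟨lt, hlt, φ, rfl⟩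
    rwa [h] at this
  · intro h
    refine Set.eq_singleton_iff_unique_mem.2 ⟨⟨_, hid, RelIso.refl _, ?_⟩, ?_⟩
    · exact ((degRel_imageRel_graphRel _ _).2 (h _ hid _)).symm
    · rintro d ⟨lt, hlt, φ, rfl⟩
      exact (degRel_imageRel_graphRel _ _).2 (h _ hlt _)

theorem IntrinsicallyComputable.of_almost {f : ℕ → ℕ}
    (h : AlmostConstant f ∨ AlmostIdentity f) :
    IntrinsicallyComputable (graphRel f) := by
  rw [intrinsicallyComputable_graphRel_iff]
  intro lt _ φ
  refine ComputablePred.eq_pred (f := fun x : ℕ × ℕ => φ (f (φ.symm x.1)))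
    (Computable.comp (f := fun x => φ (f (φ.symm x))) ?_ Computable.fst) Computable.snd
  rcases h with ⟨c, hc⟩ | hc
  · refine Computable.of_finite_ne (Computable.const (φ c)) ((hc.image φ).subset fun x hx => ?_)
    exact ⟨φ.symm x, fun h => hx (by simp [h]), by simp⟩
  · refine Computable.of_finite_ne Computable.id ((Set.Finite.image φ hc).subset fun x hx => ?_)
    exact ⟨φ.symm x, fun h => hx (by simp [h]), by simp⟩

/-! ### Computable copies from codings and from approximations -/

theorem exists_computable_enumeration {D : ℕ → Prop} (hD : ComputablePred D)
    (hinf : ∀ n, ∃ m, n ≤ m ∧ D m) :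
    ∃ d : ℕ → ℕ, Computable d ∧ StrictMono d ∧ Set.range d = {n | D n} := by
  classical
  have hP : ComputablePred fun p : ℕ × ℕ => p.1 ≤ p.2 ∧ D p.2 :=
    (ComputablePred.le_pred Computable.fst Computable.snd).and_pred
      (hD.comp_computable Computable.snd)
  have hfind := Computable.find (P := fun n m => n ≤ m ∧ D m) hP hinf
  set F : ℕ → ℕ := fun n => Nat.find (hinf n) with hF
  have hF1 : ∀ n, n ≤ F n ∧ D (F n) := fun n => Nat.find_spec (hinf n)
  have hF2 : ∀ n m, n ≤ m → D m → F n ≤ m := fun n m h1 h2 => Nat.find_min' (hinf n) ⟨h1, h2⟩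
  obtain ⟨d, hd0, hdS, hd⟩ : ∃ d : ℕ → ℕ, d 0 = F 0 ∧ (∀ n, d (n + 1) = F (d n + 1)) ∧
      Computable d := by
    refine ⟨fun n => Nat.rec (F 0) (fun _ x => F (x + 1)) n, rfl, fun _ => rfl, ?_⟩
    refine Computable.nat_rec (f := fun n : ℕ => n) (g := fun _ => F 0)
      (h := fun _ p => F (p.2 + 1)) Computable.id (Computable.const _) ?_
    exact hfind.comp (Computable.succ.comp (Computable.snd.comp Computable.snd))
  have hmono : StrictMono d := strictMono_nat_of_lt_succ fun n => hdS n ▸ (hF1 (d n + 1)).1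
  refine ⟨d, hd, hmono, ?_⟩
  ext m
  simp only [Set.mem_range, Set.mem_ofPred_eq]
  constructor
  · rintro ⟨n, rfl⟩
    cases n with
    | zero => exact hd0 ▸ (hF1 0).2
    | succ n => exact hdS n ▸ (hF1 (d n + 1)).2
  · intro hm
    have hex : ∃ n, m ≤ d n := ⟨m, hmono.id_le m⟩
    refine ⟨Nat.find hex, le_antisymm ?_ (Nat.find_spec hex)⟩
    rcases hn : Nat.find hex with _ | n
    · exact hd0 ▸ hF2 0 m (Nat.zero_le _) hm
    · exact hdS n ▸ hF2 _ m (not_le.1 (Nat.find_min hex (m := n) (by omega))) hm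

/-- The true position `ψ` need not be computable: only the comparison of codes must be. Enumerating
`D` increasingly turns codes into all of `ℕ`. -/
theorem exists_computableCopy_of_coding {D : ℕ → Prop} {less : ℕ → ℕ → Prop} {ψ a : ℕ → ℕ}
    (hD : ComputablePred D) (hless : ComputablePred fun p : ℕ × ℕ => less p.1 p.2)
    (hψ : ∀ x y, D x → D y → (less x y ↔ ψ x < ψ y))
    (hinj : ∀ x y, D x → D y → ψ x = ψ y → x = y) (hsurj : ∀ n, ∃ x, D x ∧ ψ x = n)
    (ha : Computable a) (haD : ∀ n, D (a n)) :
    ∃ lt : ℕ → ℕ → Prop, IsComputableCopy lt ∧ ∃ φ : ((· < ·) : ℕ → ℕ → Prop) ≃r lt,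
      ∃ b : ℕ → ℕ, Computable b ∧ ∀ n, φ.symm (b n) = ψ (a n) := by
  classical
  have hinf : ∀ n, ∃ m, n ≤ m ∧ D m := by
    by_contra! h
    obtain ⟨n, hn⟩ := h
    have hfin : {x | D x}.Finite := (Set.finite_lt_nat n).subset fun x hx =>
      lt_of_not_ge fun h => hn x h hx
    refine Set.infinite_univ ((hfin.image ψ).subset fun k _ => ?_)
    obtain ⟨x, hx, rfl⟩ := hsurj k
    exact ⟨x, hx, rfl⟩
  obtain ⟨d, hd, hmono, hrange⟩ := exists_computable_enumeration hD hinf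
  have hdD : ∀ n, D (d n) := fun n => by
    have : d n ∈ {n | D n} := hrange ▸ Set.mem_range_self n
    exact this
  have hdsurj : ∀ x, D x → ∃ n, d n = x := fun x hx => by
    have : x ∈ Set.range d := hrange ▸ hx
    exact this
  have hbij : Function.Bijective fun n => ψ (d n) := by
    constructor
    · intro m n h
      exact hmono.injective (hinj _ _ (hdD _) (hdD _) h)
    · intro n
      obtain ⟨x, hx, rfl⟩ := hsurj n
      obtain ⟨m, rfl⟩ := hdsurj x hx
      exact ⟨m, rfl⟩
  let e : ℕ ≃ ℕ := Equiv.ofBijective _ hbij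
  have he : ∀ n, e n = ψ (d n) := fun n => rfl
  let lt : ℕ → ℕ → Prop := fun m n => e m < e n
  let φ : ((· < ·) : ℕ → ℕ → Prop) ≃r lt := ⟨e.symm, by simp [lt]⟩
  have hcomp : ComputablePred fun p : ℕ × ℕ => lt p.1 p.2 := by
    refine (hless.comp_computable ((hd.comp Computable.fst).pair (hd.comp Computable.snd))).of_eq ?_
    intro p
    simp only [lt, he]
    exact hψ _ _ (hdD _) (hdD _)
  have hex : ∀ n, ∃ m, d m = a n := fun n => hdsurj _ (haD n)
  refine ⟨lt, ⟨φ.symm.toRelEmbedding.isStrictTotalOrder, hcomp, ⟨φ⟩⟩, φ,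
    fun n => Nat.find (hex n), ?_, fun n => ?_⟩
  · exact Computable.find (P := fun n m => d m = a n)
      (ComputablePred.eq_pred (hd.comp Computable.snd) (ha.comp Computable.fst)) hex
  · change e (Nat.find (hex n)) = _
    rw [he, Nat.find_spec (hex n)]

/-- Nondecreasing gaps mean that elements are only ever inserted between markers. An element is
coded by its column (the marker to its left), its offset there, and the stage at which it appears;
column and offset decide the order without knowledge of `P`. -/
theorem exists_computableCopy_of_approximation {p : ℕ → ℕ → ℕ} {P : ℕ → ℕ} (hp : Computable₂ p)
    (hp0 : ∀ s, p 0 s = 0) (hlt : ∀ c s, p c s < p (c + 1) s)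
    (hgap : ∀ c s, p (c + 1) s - p c s ≤ p (c + 1) (s + 1) - p c (s + 1))
    (hlim : ∀ c, ∃ S, ∀ s, S ≤ s → p c s = P c) :
    ∃ lt : ℕ → ℕ → Prop, IsComputableCopy lt ∧ ∃ φ : ((· < ·) : ℕ → ℕ → Prop) ≃r lt,
      ∃ b : ℕ → ℕ, Computable b ∧ ∀ c, φ.symm (b c) = P c := by
  classical
  set g : ℕ → ℕ → ℕ := fun c s => p (c + 1) s - p c s with hg
  have hgc : Computable₂ g := by
    refine Primrec.nat_sub.to_comp.comp (hp.comp (Computable.succ.comp Computable.fst)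
      Computable.snd) (hp.comp Computable.fst Computable.snd)
  have hgm : ∀ c, Monotone (g c) := fun c => monotone_nat_of_le_succ (hgap c)
  have hg0 : ∀ c s, 0 < g c s := fun c s => Nat.sub_pos_of_lt (hlt c s)
  have hglim : ∀ c, ∃ S, ∀ s, S ≤ s → g c s = P (c + 1) - P c := by
    intro c
    obtain ⟨S, hS⟩ := hlim c
    obtain ⟨S', hS'⟩ := hlim (c + 1)
    exact ⟨max S S', fun s hs => by
      simp only [hg]; rw [hS s (le_trans (le_max_left _ _) hs), hS' s (le_trans (le_max_right _ _) hs)]⟩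
  have hgle : ∀ c s, g c s ≤ P (c + 1) - P c := by
    intro c s
    obtain ⟨S, hS⟩ := hglim c
    rw [← hS (max s S) (le_max_right _ _)]
    exact hgm c (le_max_left _ _)
  have hP0 : P 0 = 0 := by
    obtain ⟨S, hS⟩ := hlim 0
    rw [← hS S le_rfl, hp0]
  have hPmono : StrictMono P := by
    refine strictMono_nat_of_lt_succ fun c => ?_
    have := (hg0 c 0).trans_le (hgle c 0)
    omega
  let col : ℕ → ℕ := fun x => x.unpair.1
  let off : ℕ → ℕ := fun x => x.unpair.2.unpair.1
  let stg : ℕ → ℕ := fun x => x.unpair.2.unpair.2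
  have hcol : Computable col := Computable.fst.comp Computable.unpair
  have hun2 : Computable fun x : ℕ => x.unpair.2.unpair :=
    Computable.unpair.comp (Computable.snd.comp Computable.unpair)
  have hoff : Computable off := Computable.fst.comp hun2
  have hstg : Computable stg := Computable.snd.comp hun2
  have hext : ∀ x y, col x = col y → off x = off y → stg x = stg y → x = y := by
    intro x y h1 h2 h3
    rw [← Nat.pair_unpair x, ← Nat.pair_unpair y, ← Nat.pair_unpair x.unpair.2,
      ← Nat.pair_unpair y.unpair.2]
    simp only [col, off, stg] at h1 h2 h3
    rw [h1, h2, h3]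
  -- The stage must be the first at which the gap exceeds the offset, so each position has exactly
  -- one code.
  let D : ℕ → Prop := fun x =>
    off x < g (col x) (stg x) ∧ (stg x = 0 ∨ g (col x) (stg x - 1) ≤ off x)
  let ψ : ℕ → ℕ := fun x => P (col x) + off x
  let less : ℕ → ℕ → Prop := fun x y => col x < col y ∨ col x = col y ∧ off x < off y
  have hψlt : ∀ x, D x → ψ x < P (col x + 1) := by
    intro x hx
    have := hx.1.trans_le (hgle _ _)
    have := hPmono (Nat.lt_succ_self (col x))
    simp only [ψ]
    omega
  have hless1 : ∀ x y, D x → less x y → ψ x < ψ y := by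
    rintro x y hx (h | ⟨h, h'⟩)
    · have h1 := hψlt x hx
      have h2 := hPmono.monotone (Nat.succ_le_of_lt h)
      simp only [ψ, Nat.succ_eq_add_one] at h1 h2 ⊢
      omega
    · simp only [ψ, h]; omega
  have htri : ∀ x y, ¬ less x y → ¬ less y x → col x = col y ∧ off x = off y := by
    intro x y h1 h2
    simp only [less] at h1 h2
    omega
  refine exists_computableCopy_of_coding (D := D) (less := less) (ψ := ψ)
    (a := fun c => Nat.pair c (Nat.pair 0 0)) ?_ ?_ ?_ ?_ ?_ ?_ ?_ |> fun ⟨lt, h1, φ, b, h2, h3⟩ =>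
      ⟨lt, h1, φ, b, h2, fun c => (h3 c).trans (by simp [ψ, col, off])⟩
  · refine (ComputablePred.lt_pred hoff (hgc.comp hcol hstg)).and_pred
      ((ComputablePred.eq_pred hstg (Computable.const 0)).or_pred
        (ComputablePred.le_pred (hgc.comp hcol (Computable.pred.comp hstg)) hoff))
  · have h1 := hcol.comp (Computable.fst (α := ℕ) (β := ℕ))
    have h2 := hcol.comp (Computable.snd (α := ℕ) (β := ℕ))
    exact (ComputablePred.lt_pred h1 h2).or_pred ((ComputablePred.eq_pred h1 h2).and_pred
      (ComputablePred.lt_pred (hoff.comp Computable.fst) (hoff.comp Computable.snd)))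
  · intro x y hx hy
    refine ⟨hless1 x y hx, fun h => ?_⟩
    by_contra h1
    by_cases h2 : less y x
    · exact absurd (hless1 y x hy h2) (by omega)
    · obtain ⟨h3, h4⟩ := htri x y h1 h2
      simp only [ψ, h3, h4, lt_irrefl] at h
  · intro x y hx hy h
    obtain ⟨h1, h2⟩ := htri x y (fun h1 => absurd (hless1 x y hx h1) (by omega))
      (fun h1 => absurd (hless1 y x hy h1) (by omega))
    refine hext x y h1 h2 ?_
    have key : ∀ x y, D x → D y → col x = col y → off x = off y → ¬ stg x < stg y := by
      intro x y hx hy h1 h2 h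
      rcases hy.2 with h0 | h0
      · omega
      · have := hgm (col y) (show stg x ≤ stg y - 1 by omega)
        have h3 := hx.1
        rw [h1] at h3
        omega
    exact le_antisymm (not_lt.1 (key y x hy hx h1.symm h2.symm)) (not_lt.1 (key x y hx hy h1 h2))
  · intro n
    have hex : ∃ c, n < P (c + 1) := ⟨n, (hPmono.id_le n).trans_lt (hPmono n.lt_succ_self)⟩
    obtain ⟨c, hc1, hc2⟩ : ∃ c, P c ≤ n ∧ n < P (c + 1) := by
      refine ⟨Nat.find hex, ?_, Nat.find_spec hex⟩
      rcases hc : Nat.find hex with _ | c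
      · omega
      · exact not_lt.1 (Nat.find_min hex (m := c) (by omega))
    have hs : ∃ s, n - P c < g c s := by
      obtain ⟨S, hS⟩ := hglim c
      exact ⟨S, by rw [hS S le_rfl]; omega⟩
    refine ⟨Nat.pair c (Nat.pair (n - P c) (Nat.find hs)), ⟨?_, ?_⟩, ?_⟩
    · simpa [col, off, stg] using Nat.find_spec hs
    · simp only [col, off, stg, Nat.unpair_pair]
      rcases Nat.eq_zero_or_pos (Nat.find hs) with h | h
      · exact Or.inl h
      · exact Or.inr (not_lt.1 (Nat.find_min hs (Nat.sub_lt h one_pos)))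
    · simp only [ψ, col, off, Nat.unpair_pair]
      omega
  · exact Primrec₂.natPair.to_comp.comp Computable.id (Computable.const _)
  · intro c
    refine ⟨?_, Or.inl ?_⟩
    · simpa [col, off, stg] using hg0 c 0
    · simp [stg]

/-! ### Coding tables -/

theorem exists_computable_choice {α : Type*} {T : α → ℕ → Prop} [Primcodable α]
    (hT : ComputablePred fun p : α × ℕ => T p.1 p.2) (hex : ∀ s, ∃ t, T s t) :
    ∃ F : α → ℕ, Computable F ∧ ∀ s, T s (F s) := by
  classical
  exact ⟨_, Computable.find hT hex, fun s => Nat.find_spec (hex s)⟩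

/-- Interleaved sequences of pairs `(X n false, Y n false)` satisfying `A` and pairs
`(X n true, Y n true)` satisfying `B`, growing fast and with nondecreasing gaps. -/
structure IsCodingTable (A B : ℕ → ℕ → Prop) (X Y : ℕ → Bool → ℕ) : Prop where
  computable_left : Computable₂ X
  computable_right : Computable₂ Y
  pos : ∀ n b, 0 < X n b
  lt : ∀ n b, X n b < Y n b
  holds_left : ∀ n, A (X n false) (Y n false)
  holds_right : ∀ n, B (X n true) (Y n true)
  growth_succ : ∀ n b, 2 * (Y n false + Y n true) < X (n + 1) b
  gap_false_succ : ∀ n, Y n false - X n false ≤ Y (n + 1) false - X (n + 1) false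
  gap_true_succ : ∀ n, Y n false + Y n true ≤ Y (n + 1) true - X (n + 1) true

theorem exists_isCodingTable {A B : ℕ → ℕ → Prop}
    (hAc : ComputablePred fun p : ℕ × ℕ => A p.1 p.2)
    (hBc : ComputablePred fun p : ℕ × ℕ => B p.1 p.2)
    (hAlt : ∀ u v, A u v → u < v) (hA0 : ∃ u v, A u v)
    (hA : ∀ u v, A u v → ∀ N, ∃ u' v', N ≤ u' ∧ v - u ≤ v' - u' ∧ A u' v')
    (hB : ∀ N, ∃ u v, N ≤ u ∧ u + N ≤ v ∧ B u v) :
    ∃ X Y, IsCodingTable A B X Y := by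
  let x : Bool → ℕ → ℕ := fun b s => cond b s.unpair.2.unpair.1 s.unpair.1.unpair.1
  let y : Bool → ℕ → ℕ := fun b s => cond b s.unpair.2.unpair.2 s.unpair.1.unpair.2
  have hx : Computable₂ x := Computable.cond Computable.fst
    (Computable.fst.comp (Computable.unpair.comp (Computable.snd.comp
      (Computable.unpair.comp Computable.snd))))
    (Computable.fst.comp (Computable.unpair.comp (Computable.fst.comp
      (Computable.unpair.comp Computable.snd))))
  have hy : Computable₂ y := Computable.cond Computable.fst
    (Computable.snd.comp (Computable.unpair.comp (Computable.snd.comp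
      (Computable.unpair.comp Computable.snd))))
    (Computable.snd.comp (Computable.unpair.comp (Computable.fst.comp
      (Computable.unpair.comp Computable.snd))))
  have hxb (b) : Computable (x b) := hx.comp (Computable.const b) Computable.id
  have hyb (b) : Computable (y b) := hy.comp (Computable.const b) Computable.id
  let G : ℕ → Prop := fun t => A (x false t) (y false t) ∧ B (x true t) (y true t) ∧
    0 < x false t ∧ 0 < x true t ∧ x true t < y true t
  let M : ℕ → ℕ := fun s => y false s + y true s
  let T : ℕ → ℕ → Prop := fun s t => 2 * M s < x false t ∧ 2 * M s < x true t ∧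
    y false s - x false s ≤ y false t - x false t ∧ M s ≤ y true t - x true t
  have hG : ComputablePred G :=
    (hAc.comp_computable ((hxb false).pair (hyb false))).and_pred
      ((hBc.comp_computable ((hxb true).pair (hyb true))).and_pred
        ((ComputablePred.lt_pred (Computable.const 0) (hxb false)).and_pred
          ((ComputablePred.lt_pred (Computable.const 0) (hxb true)).and_pred
            (ComputablePred.lt_pred (hxb true) (hyb true)))))
  have hM : Computable M := Primrec.nat_add.to_comp.comp (hyb false) (hyb true)
  have hM2 : Computable fun s => 2 * M s := Primrec.nat_double.to_comp.comp hM
  have hgap (b) : Computable fun s => y b s - x b s :=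
    Primrec.nat_sub.to_comp.comp (hyb b) (hxb b)
  have hTc : ComputablePred fun p : ℕ × ℕ => T p.1 p.2 :=
    (ComputablePred.lt_pred (hM2.comp Computable.fst) ((hxb false).comp Computable.snd)).and_pred
      ((ComputablePred.lt_pred (hM2.comp Computable.fst)
        ((hxb true).comp Computable.snd)).and_pred
      ((ComputablePred.le_pred ((hgap false).comp Computable.fst)
        ((hgap false).comp Computable.snd)).and_pred
      (ComputablePred.le_pred (hM.comp Computable.fst) ((hgap true).comp Computable.snd))))
  have hstep : ∀ s, G s → ∃ t, G t ∧ T s t := by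
    intro s hs
    obtain ⟨u, v, h1, h2, h3⟩ := hA _ _ hs.1 (2 * M s + 1)
    obtain ⟨u', v', h4, h5, h6⟩ := hB (2 * M s + 1)
    refine ⟨Nat.pair (Nat.pair u v) (Nat.pair u' v'), ?_, ?_⟩
    · simp only [G, x, y, cond_true, cond_false, Nat.unpair_pair]
      exact ⟨h3, h6, by omega, by omega, by omega⟩
    · simp only [T, x, y, cond_true, cond_false, Nat.unpair_pair] at h2 ⊢
      exact ⟨by omega, by omega, h2, by omega⟩
  -- The premise `G s` makes the search total; it is iterated only along states satisfying `G`.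
  obtain ⟨F, hF, hFT⟩ := exists_computable_choice (T := fun s t => G s → G t ∧ T s t)
    ((hG.comp_computable Computable.fst).imp_pred
      ((hG.comp_computable Computable.snd).and_pred hTc)) (fun s => by
      by_cases hs : G s
      · obtain ⟨t, ht⟩ := hstep s hs
        exact ⟨t, fun _ => ht⟩
      · exact ⟨0, fun h => absurd h hs⟩)
  obtain ⟨s0, hs0⟩ : ∃ s, G s := by
    obtain ⟨u₀, v₀, h₀⟩ := hA0
    obtain ⟨u, v, h1, h2, h3⟩ := hA _ _ h₀ 1
    obtain ⟨u', v', h4, h5, h6⟩ := hB 1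
    refine ⟨Nat.pair (Nat.pair u v) (Nat.pair u' v'), ?_⟩
    simp only [G, x, y, cond_true, cond_false, Nat.unpair_pair]
    exact ⟨h3, h6, by omega, by omega, by omega⟩
  obtain ⟨z, hz0, hzS, hz⟩ : ∃ z : ℕ → ℕ, z 0 = s0 ∧ (∀ n, z (n + 1) = F (z n)) ∧
      Computable z := by
    refine ⟨fun n => Nat.rec s0 (fun _ s => F s) n, rfl, fun _ => rfl, ?_⟩
    exact Computable.nat_rec (f := fun n : ℕ => n) (g := fun _ => s0)
      (h := fun _ p => F p.2) Computable.id (Computable.const _)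
      (hF.comp (Computable.snd.comp Computable.snd))
  have hzG : ∀ n, G (z n) := by
    intro n
    induction n with
    | zero => rwa [hz0]
    | succ n ih => rw [hzS]; exact (hFT _ ih).1
  have hzT : ∀ n, T (z n) (z (n + 1)) := fun n => by rw [hzS]; exact (hFT _ (hzG n)).2
  refine ⟨fun n b => x b (z n), fun n b => y b (z n),
    hx.comp Computable.snd (hz.comp Computable.fst),
    hy.comp Computable.snd (hz.comp Computable.fst), ?_, ?_, fun n => (hzG n).1,
    fun n => (hzG n).2.1, ?_, fun n => (hzT n).2.2.1, fun n => (hzT n).2.2.2⟩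
  · rintro n (_ | _)
    exacts [(hzG n).2.2.1, (hzG n).2.2.2.1]
  · rintro n (_ | _)
    exacts [hAlt _ _ (hzG n).1, (hzG n).2.2.2.2]
  · rintro n (_ | _)
    exacts [(hzT n).1, (hzT n).2.1]

namespace IsCodingTable

variable {A B : ℕ → ℕ → Prop} {X Y : ℕ → Bool → ℕ}

theorem right_le (Y : ℕ → Bool → ℕ) (n : ℕ) (b : Bool) : Y n b ≤ Y n false + Y n true := by
  cases b <;> omega

theorem growth (h : IsCodingTable A B X Y) {j m : ℕ} (hjm : j < m) (b : Bool) : 2 * (Y j false + Y j true) < X m b := by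
  induction m, hjm using Nat.le_induction generalizing b with
  | base => exact h.growth_succ j b
  | succ m _ ih =>
    have h1 := h.growth_succ m b
    have h2 := ih false
    have h3 := h.lt m false
    omega

theorem right_lt_left (h : IsCodingTable A B X Y) {j m : ℕ} (hjm : j < m) (b b' : Bool) :
    Y j b < X m b' := by
  have h1 := h.growth hjm b'
  have h2 := right_le Y j b
  omega

/-- Gaps of `false` pairs never decrease along rows, and a `true` gap exceeds every gap in earlier
rows. A change from `true` to `false` is excluded, and never needed. -/
theorem gap_mono (h : IsCodingTable A B X Y) {m m' : ℕ} (hm : m < m') {b b' : Bool}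
    (hb : b ≤ b') :
    Y m b - X m b ≤ Y m' b' - X m' b' := by
  cases b'
  · obtain rfl : b = false := le_bot_iff.1 hb
    exact monotone_nat_of_le_succ (f := fun n => Y n false - X n false) h.gap_false_succ hm.le
  · obtain ⟨k, rfl⟩ : ∃ k, m' = k + 1 := ⟨m' - 1, by omega⟩
    have h1 := h.gap_true_succ k
    have h2 := right_le Y m b
    rcases (Nat.lt_succ_iff.1 hm).eq_or_lt with rfl | h3
    · omega
    · have h4 := h.growth h3 false
      have h5 := h.lt k false
      omega

/-- The factor 2 in the growth condition acts here: `Y j' c'` is below half of `X m' b'`, and `X m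
b` is below the other half. -/
theorem between_mono (h : IsCodingTable A B X Y) {j j' m m' : ℕ} (hm : m < m')
    (hj' : j' < m') (b b' c c' : Bool) : X m b - Y j c ≤ X m' b' - Y j' c' := by
  have h1 := h.growth hm b'
  have h2 := h.growth hj' b'
  have h3 := right_le Y m b
  have h4 := right_le Y j' c'
  have h5 := h.lt m b
  omega

end IsCodingTable

/-! ### Rows and marker positions -/

/-- The row of a coding table in which the `e`-th pair sits, given the bits `κ`. -/
def rowIndex (κ : ℕ → Bool) (e : ℕ) : ℕ :=
  Nat.rec (κ 0).toNat (fun i r => r + 1 + (κ (i + 1)).toNat) e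

theorem rowIndex_lt_succ (κ : ℕ → Bool) (e : ℕ) : rowIndex κ e < rowIndex κ (e + 1) := by
  simp only [rowIndex]
  omega

theorem rowIndex_mono {κ κ' : ℕ → Bool} (h : κ ≤ κ') (e : ℕ) : rowIndex κ e ≤ rowIndex κ' e := by
  induction e with
  | zero => exact Bool.toNat_le_toNat (h 0)
  | succ e ih =>
    have := Bool.toNat_le_toNat (h (e + 1))
    simp only [rowIndex] at ih ⊢
    omega

/-- Flipping a bit to `true` pushes its own pair and all later pairs into strictly later rows, so a
row that stays put certifies that no bit up to `e` has changed. -/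
theorem eq_of_rowIndex_eq {κ κ' : ℕ → Bool} (h : κ ≤ κ') {e : ℕ}
    (he : rowIndex κ e = rowIndex κ' e) : ∀ i ≤ e, κ i = κ' i := by
  have toNat_inj : ∀ a b : Bool, a.toNat = b.toNat → a = b := by decide
  induction e with
  | zero =>
    intro i hi
    obtain rfl : i = 0 := by omega
    exact toNat_inj _ _ he
  | succ e ih =>
    have h1 := Bool.toNat_le_toNat (h (e + 1))
    have h2 := rowIndex_mono h e
    simp only [rowIndex] at he h2 ih
    intro i hi
    rcases hi.eq_or_lt with rfl | hi
    · exact toNat_inj _ _ (by omega)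
    · exact ih (by omega) i (by omega)

theorem rowIndex_congr {κ κ' : ℕ → Bool} {e : ℕ} (h : ∀ i ≤ e, κ i = κ' i) :
    rowIndex κ e = rowIndex κ' e := by
  induction e with
  | zero => simp [rowIndex, h 0 le_rfl]
  | succ e ih =>
    have := ih fun i hi => h i (by omega)
    simp only [rowIndex] at this ⊢
    rw [this, h (e + 1) le_rfl]

/-- Positions of the markers: the `e`-th pair of markers is numbered `2 * e + 1`, `2 * e + 2`. -/
def markerPos (X Y : ℕ → Bool → ℕ) (κ : ℕ → Bool) (c : ℕ) : ℕ :=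
  Nat.casesOn c 0 fun m =>
    cond m.bodd (Y (rowIndex κ m.div2) (κ m.div2)) (X (rowIndex κ m.div2) (κ m.div2))

section markerPos

variable (X Y : ℕ → Bool → ℕ) (κ : ℕ → Bool) (e : ℕ)

theorem markerPos_zero : markerPos X Y κ 0 = 0 := rfl

theorem markerPos_left : markerPos X Y κ (2 * e + 1) = X (rowIndex κ e) (κ e) := by
  simp [markerPos, Nat.div2_val]

theorem markerPos_right : markerPos X Y κ (2 * e + 2) = Y (rowIndex κ e) (κ e) := by
  simp [markerPos]

theorem marker_cases {motive : ℕ → Prop} (zero : motive 0) (left : ∀ e, motive (2 * e + 1))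
    (right : ∀ e, motive (2 * e + 2)) (c : ℕ) : motive c := by
  obtain rfl | ⟨e, rfl⟩ | ⟨e, rfl⟩ : c = 0 ∨ (∃ e, c = 2 * e + 1) ∨ ∃ e, c = 2 * e + 2 := by
    rcases Nat.even_or_odd' c with ⟨k, rfl | rfl⟩
    · rcases k with _ | k
      · exact Or.inl rfl
      · exact Or.inr (Or.inr ⟨k, rfl⟩)
    · exact Or.inr (Or.inl ⟨k, rfl⟩)
  exacts [zero, left e, right e]

end markerPos

theorem computable_markerPos {X Y : ℕ → Bool → ℕ} (hX : Computable₂ X) (hY : Computable₂ Y)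
    {κ : ℕ → ℕ → Bool} (hκ : Computable₂ κ) :
    Computable₂ fun c s => markerPos X Y (fun e => κ e s) c := by
  have hrow : Computable₂ fun e s => rowIndex (fun e => κ e s) e := by
    have htoNat : Computable Bool.toNat := (Primrec.dom_finite _).to_comp
    refine Computable.nat_rec (f := fun p : ℕ × ℕ => p.1) (g := fun p => (κ 0 p.2).toNat)
      (h := fun p q => q.2 + 1 + (κ (q.1 + 1) p.2).toNat) Computable.fst
      (htoNat.comp (hκ.comp (Computable.const 0) Computable.snd)) ?_
    exact Primrec.nat_add.to_comp.comp
      (Computable.succ.comp (Computable.snd.comp Computable.snd))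
      (htoNat.comp (hκ.comp
        (Computable.succ.comp (Computable.fst.comp Computable.snd))
        (Computable.snd.comp Computable.fst)))
  have hdiv : Computable fun q : (ℕ × ℕ) × ℕ => q.2.div2 :=
    Computable.nat_div2.comp Computable.snd
  have hs : Computable fun q : (ℕ × ℕ) × ℕ => q.1.2 := Computable.snd.comp Computable.fst
  refine Computable.nat_casesOn (f := fun p : ℕ × ℕ => p.1) (g := fun _ => 0)
    (h := fun p m => cond m.bodd
      (Y (rowIndex (fun e => κ e p.2) m.div2) (κ m.div2 p.2))
      (X (rowIndex (fun e => κ e p.2) m.div2) (κ m.div2 p.2)))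
    Computable.fst (Computable.const 0) ?_
  exact Computable.cond (Computable.nat_bodd.comp Computable.snd)
    (hY.comp (hrow.comp hdiv hs) (hκ.comp hdiv hs))
    (hX.comp (hrow.comp hdiv hs) (hκ.comp hdiv hs))

/-! ### Coding the halting problem into a copy -/

theorem IsCodingTable.exists_computableCopy {A B : ℕ → ℕ → Prop} {X Y : ℕ → Bool → ℕ}
    (h : IsCodingTable A B X Y) {κ : ℕ → ℕ → Bool} (hκ : Computable₂ κ)
    (hmono : ∀ e, Monotone (κ e)) :
    ∃ lt : ℕ → ℕ → Prop, IsComputableCopy lt ∧ ∃ φ : ((· < ·) : ℕ → ℕ → Prop) ≃r lt,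
      ∃ b : ℕ → ℕ, Computable b ∧ ∀ e,
        ((∃ s, κ e s = true) → B (φ.symm (b (2 * e + 1))) (φ.symm (b (2 * e + 2)))) ∧
        ((¬ ∃ s, κ e s = true) → A (φ.symm (b (2 * e + 1))) (φ.symm (b (2 * e + 2)))) := by
  classical
  let k : ℕ → Bool := fun e => decide (∃ s, κ e s = true)
  have hk1 : ∀ e, ∃ S, ∀ s, S ≤ s → κ e s = k e := by
    intro e
    by_cases he : ∃ s, κ e s = true
    · obtain ⟨S, hS⟩ := he
      refine ⟨S, fun s hs => ?_⟩
      have h1 : k e = true := by simpa [k] using ⟨S, hS⟩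
      have h2 := hmono e hs
      rw [hS] at h2
      rw [h1]
      exact top_le_iff.1 h2
    · refine ⟨0, fun s _ => ?_⟩
      have h1 : k e = false := by simpa [k] using he
      rw [h1]
      exact Bool.eq_false_iff.2 fun hs => he ⟨s, hs⟩
  have hk : ∀ e, ∃ S, ∀ s, S ≤ s → ∀ i ≤ e, κ i s = k i := by
    choose S hS using hk1
    exact fun e => ⟨(Finset.range (e + 1)).sup S, fun s hs i hi => hS i s
      ((Finset.le_sup (f := S) (Finset.mem_range.2 (Nat.lt_succ_of_le hi))).trans hs)⟩
  have hle : ∀ s, (fun e => κ e s) ≤ fun e => κ e (s + 1) := fun s e => hmono e s.le_succ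
  have key : ∃ lt : ℕ → ℕ → Prop, IsComputableCopy lt ∧
      ∃ φ : ((· < ·) : ℕ → ℕ → Prop) ≃r lt, ∃ b : ℕ → ℕ, Computable b ∧
        ∀ c, φ.symm (b c) = markerPos X Y k c := by
    refine exists_computableCopy_of_approximation
      (computable_markerPos h.computable_left h.computable_right hκ) (fun s => rfl) ?_ ?_ ?_
    · intro c s
      induction c using marker_cases with
      | zero => exact (markerPos_left X Y _ 0).symm ▸ h.pos _ _
      | left e => rw [markerPos_left, markerPos_right]; exact h.lt _ _
      | right e =>
        rw [markerPos_right, show 2 * e + 2 + 1 = 2 * (e + 1) + 1 by ring, markerPos_left]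
        exact h.right_lt_left (rowIndex_lt_succ _ _) _ _
    -- Either the relevant row is unchanged, so the bits and the gap are too, or it has strictly
    -- increased and the table's growth conditions apply.
    · intro c s
      induction c using marker_cases with
      | zero =>
        have h0 := markerPos_left X Y
        rw [show 0 + 1 = 2 * 0 + 1 by rfl, h0, h0, markerPos_zero, markerPos_zero]
        rcases (rowIndex_mono (hle s) 0).eq_or_lt with h1 | h1
        · rw [h1, eq_of_rowIndex_eq (hle s) h1 0 le_rfl]
        · have h2 := h.right_lt_left h1 (κ 0 s) (κ 0 (s + 1))
          have h3 := h.lt (rowIndex (fun e => κ e s) 0) (κ 0 s)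
          omega
      | left e =>
        rw [markerPos_left, markerPos_right, markerPos_left, markerPos_right]
        rcases (rowIndex_mono (hle s) e).eq_or_lt with h1 | h1
        · rw [h1, eq_of_rowIndex_eq (hle s) h1 e le_rfl]
        · exact h.gap_mono h1 (hle s e)
      | right e =>
        rw [show 2 * e + 2 + 1 = 2 * (e + 1) + 1 by ring, markerPos_left, markerPos_right,
          markerPos_left, markerPos_right]
        rcases (rowIndex_mono (hle s) (e + 1)).eq_or_lt with h1 | h1
        · have h2 := eq_of_rowIndex_eq (hle s) h1
          rw [h1, h2 (e + 1) le_rfl, h2 e e.le_succ,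
            rowIndex_congr fun i hi => h2 i (hi.trans e.le_succ)]
        · exact h.between_mono h1 (rowIndex_lt_succ _ _) _ _ _ _
    · intro c
      induction c using marker_cases with
      | zero => exact ⟨0, fun _ _ => rfl⟩
      | left e =>
        obtain ⟨S, hS⟩ := hk e
        refine ⟨S, fun s hs => ?_⟩
        rw [markerPos_left, markerPos_left, hS s hs e le_rfl, rowIndex_congr (hS s hs)]
      | right e =>
        obtain ⟨S, hS⟩ := hk e
        refine ⟨S, fun s hs => ?_⟩
        rw [markerPos_right, markerPos_right, hS s hs e le_rfl, rowIndex_congr (hS s hs)]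
  obtain ⟨lt, hlt, φ, b, hb, hφ⟩ := key
  refine ⟨lt, hlt, φ, b, hb, fun e => ?_⟩
  rw [hφ, hφ, markerPos_left, markerPos_right]
  constructor
  · intro he
    have : k e = true := by simpa [k] using he
    rw [this]
    exact h.holds_right _
  · intro he
    have : k e = false := by simpa [k] using he
    rw [this]
    exact h.holds_left _

theorem exists_computable_approximation_not_computable :
    ∃ κ : ℕ → ℕ → Bool, Computable₂ κ ∧ (∀ e, Monotone (κ e)) ∧
      ¬ ComputablePred fun e => ∃ s, κ e s = true := by
  refine ⟨fun e s => (Nat.Partrec.Code.evaln s (Denumerable.ofNat Nat.Partrec.Code e) 0).isSome,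
    ?_, ?_, ?_⟩
  · exact (Primrec.option_isSome.comp (Nat.Partrec.Code.primrec_evaln.comp
      ((Primrec.snd.pair ((Primrec.ofNat _).comp Primrec.fst)).pair (Primrec.const 0)))).to_comp
  · intro e s t hst
    rw [Bool.le_iff_imp]
    intro h
    obtain ⟨x, hx⟩ := Option.isSome_iff_exists.1 h
    exact Option.isSome_iff_exists.2 ⟨x, Nat.Partrec.Code.evaln_mono hst hx⟩
  · intro h
    refine ComputablePred.halting_problem 0 ((h.comp_computable Computable.encode).of_eq ?_)
    intro c
    simp only [Denumerable.ofNat_encode, Option.isSome_iff_exists, Part.dom_iff_mem]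
    constructor
    · rintro ⟨s, x, hx⟩
      exact ⟨x, Nat.Partrec.Code.evaln_complete.2 ⟨s, hx⟩⟩
    · rintro ⟨x, hx⟩
      obtain ⟨s, hs⟩ := Nat.Partrec.Code.evaln_complete.1 hx
      exact ⟨s, x, hs⟩

/-- If some gap length does not recur (as a lower bound) arbitrarily far out, take the least such
length and a bound `N₀` past which it fails: every later `Q`-pair has a smaller gap, which recurs by
minimality. -/
theorem exists_forall_ge_extends {Q : ℕ → ℕ → Prop} :
    ∃ N₀, ∀ u v, N₀ ≤ u → u < v → Q u v →
      ∀ N, ∃ u' v', N ≤ u' ∧ u' < v' ∧ v - u ≤ v' - u' ∧ Q u' v' := by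
  classical
  let good : ℕ → Prop := fun δ => ∀ N, ∃ u v, N ≤ u ∧ u < v ∧ δ ≤ v - u ∧ Q u v
  by_cases h : ∀ δ, good δ
  · exact ⟨0, fun u v _ _ _ => h (v - u)⟩
  · push Not at h
    obtain ⟨N₀, hN₀⟩ := not_forall.1 (Nat.find_spec h)
    refine ⟨N₀, fun u v hu huv hQ => ?_⟩
    by_contra hbad
    exact hN₀ ⟨u, v, hu, huv, Nat.find_min' h hbad, hQ⟩

theorem exists_computableCopy_not_computablePred {Q : ℕ → ℕ → Prop}
    (hQ : ComputablePred fun p : ℕ × ℕ => Q p.1 p.2)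
    (hpos : ∀ N, ∃ u v, N ≤ u ∧ u < v ∧ Q u v)
    (hneg : ∀ N, ∃ u v, N ≤ u ∧ u + N ≤ v ∧ ¬ Q u v) :
    ∃ lt : ℕ → ℕ → Prop, IsComputableCopy lt ∧ ∃ φ : ((· < ·) : ℕ → ℕ → Prop) ≃r lt,
      ¬ ComputablePred fun p : ℕ × ℕ => Q (φ.symm p.1) (φ.symm p.2) := by
  obtain ⟨N₀, hN₀⟩ := exists_forall_ge_extends (Q := Q)
  have hA : ComputablePred fun p : ℕ × ℕ => N₀ ≤ p.1 ∧ p.1 < p.2 ∧ Q p.1 p.2 :=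
    (ComputablePred.le_pred (Computable.const _) Computable.fst).and_pred
      ((ComputablePred.lt_pred Computable.fst Computable.snd).and_pred hQ)
  obtain ⟨X, Y, hXY⟩ := exists_isCodingTable (A := fun u v => N₀ ≤ u ∧ u < v ∧ Q u v)
    (B := fun u v => ¬ Q u v) hA hQ.not (fun u v h => h.2.1) (hpos N₀)
    -- The maximum keeps the new pair beyond `N₀`, so that it can be extended again.
    (fun u v h N => by
      obtain ⟨u', v', h1, h2, h3, h4⟩ := hN₀ u v h.1 h.2.1 h.2.2 (max N N₀)
      exact ⟨u', v', (le_max_left _ _).trans h1, h3, (le_max_right _ _).trans h1, h2, h4⟩) hneg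
  obtain ⟨κ, hκ, hmono, hnot⟩ := exists_computable_approximation_not_computable
  obtain ⟨lt, hlt, φ, b, hb, hcode⟩ := hXY.exists_computableCopy hκ hmono
  refine ⟨lt, hlt, φ, fun h => hnot ?_⟩
  have hb1 : Computable fun e => b (2 * e + 1) := hb.comp Primrec.nat_double_succ.to_comp
  have hb2 : Computable fun e => b (2 * e + 2) :=
    hb.comp (Computable.succ.comp Primrec.nat_double_succ.to_comp)
  refine (h.comp_computable (hb1.pair hb2)).not.of_eq fun e => ?_
  by_cases he : ∃ s, κ e s = true
  · exact iff_of_true ((hcode e).1 he) he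
  · exact iff_of_false (not_not_intro ((hcode e).2 he).2.2) he

/-! ### Application to graphs of functions -/

theorem IntrinsicallyComputable.almost {f : ℕ → ℕ} (hf : Computable f)
    (h : IntrinsicallyComputable (graphRel f)) : AlmostConstant f ∨ AlmostIdentity f := by
  rw [intrinsicallyComputable_graphRel_iff] at h
  by_contra! hcon
  obtain ⟨hconst, hid⟩ := hcon
  have large : ∀ {p : ℕ → Prop}, {x | p x}.Infinite → ∀ N, ∃ x, N ≤ x ∧ p x := fun hp N => by
    obtain ⟨x, hx, hN⟩ := hp.exists_gt N
    exact ⟨x, hN.le, hx⟩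
  by_cases hfib : ∃ c, {x | f x = c}.Infinite
  · obtain ⟨c, hc⟩ := hfib
    have hc' : {x | f x ≠ c}.Infinite := fun hfin => hconst ⟨c, hfin⟩
    obtain ⟨lt, hlt, φ, hφ⟩ := exists_computableCopy_not_computablePred
      -- The left coordinate is a dummy; it leaves the gap free to be as large as required.
      (Q := fun _ v => f v = c)
      (ComputablePred.eq_pred (hf.comp Computable.snd) (Computable.const c))
      (fun N => by
        obtain ⟨v, hv, h⟩ := large hc (N + 1)
        exact ⟨N, v, le_rfl, hv, h⟩)
      (fun N => by
        obtain ⟨v, hv, h⟩ := large hc' (N + N)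
        exact ⟨N, v, le_rfl, hv, h⟩)
    refine hφ (((h lt hlt φ).comp_computable
      (Computable.snd.pair (Computable.const (φ c)))).of_eq fun p => ?_)
    simp
  · push Not at hfib
    -- Finite fibres make `f` tend to infinity, so the pairs `(f v, v)` with `f v < v` occur
    -- arbitrarily far out.
    have hfin : ∀ N, ∃ K, ∀ x, K ≤ x → N ≤ f x := by
      intro N
      have : {x | f x < N}.Finite := by
        refine ((Set.finite_lt_nat N).biUnion fun c _ => hfib c).subset fun x hx => ?_
        simpa using hx
      obtain ⟨K, hK⟩ := this.bddAbove
      exact ⟨K + 1, fun x hx => not_lt.1 fun h => absurd (hK h) (by omega)⟩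
    have hsplit : {x | f x < x}.Infinite ∨ {x | x < f x}.Infinite := by
      rw [← Set.infinite_union]
      have hne : {x | f x ≠ x}.Infinite := hid
      refine hne.mono fun x hx => ?_
      simpa using lt_or_gt_of_ne (show f x ≠ x from hx)
    rcases hsplit with hlow | hhigh
    · obtain ⟨lt, hlt, φ, hφ⟩ := exists_computableCopy_not_computablePred
        (Q := fun u v => f v = u)
        (ComputablePred.eq_pred (hf.comp Computable.snd) Computable.fst)
        (fun N => by
          obtain ⟨K, hK⟩ := hfin N
          obtain ⟨v, hv, h⟩ := large hlow K
          exact ⟨f v, v, hK v hv, h, rfl⟩)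
        (fun N => by
          obtain ⟨K, hK⟩ := hfin (N + 1)
          refine ⟨N, K + (N + N), le_rfl, by omega, fun h => ?_⟩
          have := hK (K + (N + N)) (by omega)
          omega)
      refine hφ (((h lt hlt φ).comp_computable
        (Computable.snd.pair Computable.fst)).of_eq fun p => ?_)
      exact (RelIso.eq_symm_apply φ).symm
    · obtain ⟨lt, hlt, φ, hφ⟩ := exists_computableCopy_not_computablePred
        (Q := fun u v => f u = v)
        (ComputablePred.eq_pred (hf.comp Computable.fst) Computable.snd)
        (fun N => by
          obtain ⟨u, hu, h⟩ := large hhigh N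
          exact ⟨u, f u, hu, h, rfl⟩)
        (fun N => ⟨N, N + N + f N + 1, le_rfl, by omega, by omega⟩)
      refine hφ ((h lt hlt φ).of_eq fun p => ?_)
      exact (RelIso.eq_symm_apply φ).symm

theorem mainTheorem7 (f : ℕ → ℕ) (hf : Computable f) :
    IntrinsicallyComputable (graphRel f) ↔ AlmostConstant f ∨ AlmostIdentity f :=
  ⟨IntrinsicallyComputable.almost hf, IntrinsicallyComputable.of_almost⟩
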